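/- Let $V$ be a finite set. For a DAG $G$ on $V$ and $S\subseteq V$, let $G_S$ be the interventional graph obtained from $G$ by deleting all arcs into vertices of $S$. Two DAGs on $V$ are Markov equivalent if, for all choices of finite nonempty state spaces for the variables indexed by $V$, the same joint distributions factorize as $f(x)=\prod_{v\in V} f(x_v\mid x_{\mathrm{Pa}(v)})$ according to the two DAGs; $[G]$ denotes the Markov equivalence class of $G$. For a set $\mathcal I\subseteq 2^V$ of interventions, the $\mathcal I$-essential graph $\mathcal E_{\mathcal I}(G)$ is the partially directed graph representing the class of all $H\in[G]$ such that $H_S$ is Markov equivalent to $G_S$ for every $S\in\mathcal I$: it has an arc $u\to v$ if every member of this class has the arc $u\to v$, and an undirected edge $u\sim v$ if one member has $u\to v$ and another has $v\to u$. Call $\mathcal I$ a verifying set for $G$ if $\mathcal E_{\mathcal I}(G)=G$, and atomic if $|S|=1$ for all $S\in\mathcal I$. Let $\nu_1(G)$ be the minimum of $|\mathcal I|$ over all atomic verifying sets $\mathcal I$ for $G$. **Theorem.** For every DAG $G^*$ on a finite vertex set, $$\max_{G\in[G^*]}\nu_1(G)\;\le\;2\cdot\min_{G\in[G^*]}\nu_1(G).$$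 -/

import Mathlib

/-- A directed acyclic graph on the vertex set `V`: `G.Adj u v` is the arc `u → v`, and no vertex
reaches itself along a nonempty directed walk. -/
@[ext]
structure DAG (V : Type*) extends Digraph V where
  acyclic : ∀ v, ¬ Relation.TransGen Adj v v

/-- A partially directed graph: `Arc u v` is a directed edge `u → v`, `Edge u v` an undirected
edge `u ∼ v`. -/
@[ext]
structure PDGraph (V : Type*) where
  Arc : V → V → Prop
  Edge : V → V → Prop

namespace DAG

variable {V : Type*}

/-- A DAG as a partially directed graph, all of whose edges are directed. -/
def toPDGraph (G : DAG V) : PDGraph V where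
  Arc := G.Adj
  Edge := fun _ _ => False

/-- The interventional graph `G_S` of the ideal intervention on `S`: all arcs into vertices of `S`
are removed. -/
def intervene (G : DAG V) (S : Finset V) : DAG V where
  Adj u v := G.Adj u v ∧ v ∉ S
  acyclic v h := by
    have hmono : ∀ w, Relation.TransGen (fun u v => G.Adj u v ∧ v ∉ S) v w →
        Relation.TransGen G.Adj v w := by
      intro w hw
      induction hw with
      | single hab => exact .single hab.1
      | tail _ hbc ih => exact ih.tail hbc.1
    exact G.acyclic v (hmono v h)

theorem asymm (G : DAG V) {u v : V} (h : G.Adj u v) : ¬ G.Adj v u := fun h' =>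
  G.acyclic u (Relation.TransGen.head h (Relation.TransGen.single h'))

theorem ne_of_adj (G : DAG V) {u v : V} (h : G.Adj u v) : u ≠ v := by
  rintro rfl
  exact G.asymm h h

section Finite

variable [Fintype V]

/-- The Markov (factorization) property. The function `f`, on assignments of values `x v ∈ Ω v` to
the vertices, is a product over the vertices `v` of conditional probability distributions
`k v x a = f(v = a | pa(v))`: each is a probability distribution on `Ω v` that depends on `x` only
through the values at the parents of `v`. Such an `f` is a joint probability mass function. -/
def Factorizes (G : DAG V) (Ω : V → Type) [∀ v, Fintype (Ω v)] (f : (∀ v, Ω v) → ℝ) : Prop :=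
  ∃ k : ∀ v, (∀ u, Ω u) → Ω v → ℝ,
    (∀ v x y, (∀ u, G.Adj u v → x u = y u) → k v x = k v y) ∧
    (∀ v x a, 0 ≤ k v x a) ∧
    (∀ v x, ∑ a, k v x a = 1) ∧
    ∀ x, f x = ∏ v, k v x (x v)

/-- Markov equivalence: for all choices of (finite, nonempty) state spaces of the variables, the
two DAGs have the same Markov model, that is, the same joint distributions factorize according to
the two DAGs. (Finite state spaces of all sizes separate the same DAGs as arbitrary ones do.) -/
def MarkovEquiv (G H : DAG V) : Prop :=
  ∀ (Ω : V → Type) [∀ v, Fintype (Ω v)] [∀ v, Nonempty (Ω v)] (f : (∀ v, Ω v) → ℝ),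
    G.Factorizes Ω f ↔ H.Factorizes Ω f

/-- The Markov equivalence class `[G]`. -/
def MEC (G : DAG V) : Set (DAG V) := {H | MarkovEquiv G H}

/-- The interventional Markov equivalence class of `G` for the intervention set `I`: the DAGs that
are Markov equivalent to `G` and whose interventional graph for each `S ∈ I` is Markov equivalent
to that of `G`. -/
def interventionalMEC (G : DAG V) (I : Finset (Finset V)) : Set (DAG V) :=
  {H | H ∈ G.MEC ∧ ∀ S ∈ I, MarkovEquiv (G.intervene S) (H.intervene S)}

/-- The `I`-essential graph of `G`: an arc `u → v` for the arcs shared by all members of the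
interventional Markov equivalence class, an undirected edge `u ∼ v` where two members disagree on
the direction. -/
def essentialGraph (G : DAG V) (I : Finset (Finset V)) : PDGraph V where
  Arc u v := ∀ H ∈ G.interventionalMEC I, H.Adj u v
  Edge u v := ∃ H₁ ∈ G.interventionalMEC I, ∃ H₂ ∈ G.interventionalMEC I,
    H₁.Adj u v ∧ H₂.Adj v u

/-- `I` is a verifying set for `G` if the `I`-essential graph of `G` is `G` itself. -/
def IsVerifyingSet (G : DAG V) (I : Finset (Finset V)) : Prop :=
  G.essentialGraph I = G.toPDGraph

/-- Every intervention in `I` is a single vertex. -/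
def IsAtomic (I : Finset (Finset V)) : Prop := ∀ S ∈ I, S.card = 1

/-- The atomic verification number `ν₁(G)`: the least size of an atomic verifying set for `G`.
The minimum is attained, by `exists_atomic_verifyingSet` below. -/
noncomputable def verificationNumber (G : DAG V) : ℕ :=
  sInf {n | ∃ I : Finset (Finset V), IsAtomic I ∧ G.IsVerifyingSet I ∧ I.card = n}

/-- Markov equivalent DAGs have the same skeleton: a perfectly correlated pair of fair bits at
`u` and `v`, all other variables being constant, factorizes only if `u` and `v` are adjacent. -/
theorem MarkovEquiv.adj_or {G H : DAG V} (e : MarkovEquiv G H) {u v : V} (h : G.Adj u v) :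
    H.Adj u v ∨ H.Adj v u := by
  classical
  have huv : u ≠ v := G.ne_of_adj h
  let Ω : V → Type := fun w => {b : Bool // b = true → w = u ∨ w = v}
  have : ∀ w, Nonempty (Ω w) := fun w => ⟨⟨false, by simp⟩⟩
  let f : (∀ w, Ω w) → ℝ := fun x => if (x u).1 = (x v).1 then 1 / 2 else 0
  have hsub : ∀ w, w ≠ u → w ≠ v → ∀ b : Ω w, b.1 = false := by
    intro w h1 h2 b
    rcases hb : b.1 with _ | _
    · rfl
    · exact absurd (b.2 hb) (by simp [h1, h2])
  have hprod : ∀ g : V → ℝ, (∀ w, w ≠ u → w ≠ v → g w = 1) → ∏ w, g w = g u * g v := by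
    intro g hg
    rw [← Finset.prod_pair huv]
    symm
    apply Finset.prod_subset (Finset.subset_univ _)
    intro w _ hw
    simp only [Finset.mem_insert, Finset.mem_singleton, not_or] at hw
    exact hg w hw.1 hw.2
  have hsum : ∀ w, ∀ (hw : w = u ∨ w = v), ∀ g : Ω w → ℝ,
      ∑ a, g a = g ⟨false, by simp⟩ + g ⟨true, fun _ => hw⟩ := by
    intro w hw g
    have hne : (⟨false, by simp⟩ : Ω w) ≠ ⟨true, fun _ => hw⟩ := by
      intro hc
      have := congrArg Subtype.val hc
      simp at this
    rw [← Finset.sum_pair hne]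
    symm
    apply Finset.sum_subset (Finset.subset_univ _)
    rintro ⟨_ | _, hb⟩ _ hw' <;> simp at hw'
  have hsum1 : ∀ w, w ≠ u → w ≠ v → ∀ g : Ω w → ℝ, ∀ b, ∑ a, g a = g b := by
    intro w h1 h2 g b
    apply Fintype.sum_eq_single
    intro a ha
    exact absurd (Subtype.ext ((hsub w h1 h2 a).trans (hsub w h1 h2 b).symm)) ha
  have hG : G.Factorizes Ω f := by
    refine ⟨fun w x a => if w = u then 1 / 2 else if w = v then
      (if a.1 = (x u).1 then 1 else 0) else 1, ?_, ?_, ?_, ?_⟩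
    · intro w x y hxy
      funext a
      by_cases hv : w = v
      · subst hv
        simp only [hxy u h]
      · simp [hv]
    · intro w x a
      dsimp only
      split_ifs <;> norm_num
    · intro w x
      by_cases h1 : w = u
      · rw [hsum w (Or.inl h1)]
        simp only [h1, if_true]
        norm_num
      · by_cases h2 : w = v
        · rw [hsum w (Or.inr h2)]
          simp only [h2, huv.symm, if_true, if_false]
          rcases (x u).1 with _ | _ <;> simp
        · rw [hsum1 w h1 h2 _ ⟨false, by simp⟩]
          simp [h1, h2]
    · intro x
      rw [hprod _ (fun w h1 h2 => by simp [h1, h2])]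
      simp only [f, huv.symm, if_true, if_false]
      by_cases hx : (x u).1 = (x v).1
      · simp [hx]
      · simp [hx, Ne.symm hx]
  obtain ⟨k, hk, -, hk1, hf⟩ := (e Ω f).1 hG
  by_contra hno
  rw [not_or] at hno
  let c : Bool → Bool → ∀ w, Ω w := fun a b w =>
    ⟨(decide (w = u) && a) || (decide (w = v) && b), by
      intro hb
      simp only [Bool.or_eq_true, Bool.and_eq_true, decide_eq_true_eq] at hb
      exact hb.imp And.left And.left⟩
  have hcv : ∀ a a' b w, w ≠ u → c a b w = c a' b w := by
    intro a a' b w hw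
    simp [c, hw]
  have hcu : ∀ a b b' w, w ≠ v → c a b w = c a b' w := by
    intro a b b' w hw
    simp [c, hw]
  have hfc : ∀ a b, f (c a b) = k u (c a false) (c a false u) * k v (c false b) (c false b v) := by
    intro a b
    rw [hf, hprod]
    · congr 1
      · rw [hk u (c a b) (c a false), hcu a b false u huv]
        intro w hw
        exact hcu a b false w (fun hc => hno.2 (hc ▸ hw))
      · rw [hk v (c a b) (c false b), hcv a false b v huv.symm]
        intro w hw
        exact hcv a false b w (fun hc => hno.1 (hc ▸ hw))
    · intro w h1 h2
      rw [← hsum1 w h1 h2 (k w (c a b)), hk1]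
  have e1 := hfc true true
  have e2 := hfc false false
  have e3 := hfc true false
  have e4 := hfc false true
  have hval : ∀ a b, f (c a b) = if a = b then 1 / 2 else 0 := by
    intro a b
    simp [f, c, huv, huv.symm]
  rw [hval] at e1 e2 e3 e4
  simp only [if_true, Bool.true_eq_false, Bool.false_eq_true, if_false] at e1 e2 e3 e4
  rcases mul_eq_zero.1 e3.symm with h0 | h0
  · rw [h0] at e1
    norm_num at e1
  · rw [h0] at e2
    norm_num at e2

theorem MarkovEquiv.symm {G H : DAG V} (e : MarkovEquiv G H) : MarkovEquiv H G := by
  intro Ω _ _ f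
  exact (e Ω f).symm

/-- Atomic verifying sets exist, so that the verification number is a minimum: intervening on
every vertex reveals all directions. -/
theorem exists_atomic_verifyingSet (G : DAG V) :
    ∃ I : Finset (Finset V), IsAtomic I ∧ G.IsVerifyingSet I := by
  classical
  let I : Finset (Finset V) := Finset.univ.image fun v => {v}
  have key : ∀ H ∈ G.interventionalMEC I, ∀ u v, H.Adj u v ↔ G.Adj u v := by
    intro H hH
    have hI : ∀ v, MarkovEquiv (G.intervene {v}) (H.intervene {v}) := fun v =>
      hH.2 {v} (Finset.mem_image_of_mem _ (Finset.mem_univ v))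
    have aux : ∀ A B : DAG V, (∀ v, MarkovEquiv (A.intervene {v}) (B.intervene {v})) →
        ∀ u v, A.Adj u v → B.Adj u v := by
      intro A B hAB u v h
      have h' : (A.intervene {u}).Adj u v :=
        show A.Adj u v ∧ v ∉ ({u} : Finset V) from
          ⟨h, by simpa using (A.ne_of_adj h).symm⟩
      have h2 : (B.Adj u v ∧ v ∉ ({u} : Finset V)) ∨ (B.Adj v u ∧ u ∉ ({u} : Finset V)) :=
        (hAB u).adj_or h'
      rcases h2 with h2 | h2
      · exact h2.1
      · exact absurd h2.2 (by simp)
    exact fun u v => ⟨aux H G (fun v => (hI v).symm) u v, aux G H hI u v⟩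
  have hGI : G ∈ G.interventionalMEC I :=
    ⟨fun _ _ _ _ => Iff.rfl, fun _ _ _ _ _ _ => Iff.rfl⟩
  refine ⟨I, ?_, ?_⟩
  · intro S hS
    obtain ⟨v, -, rfl⟩ := Finset.mem_image.1 hS
    exact Finset.card_singleton v
  · apply PDGraph.ext
    · funext u v
      exact propext ⟨fun h => h G hGI, fun h H hH => (key H hH u v).2 h⟩
    · funext u v
      refine propext ⟨?_, False.elim⟩
      rintro ⟨H₁, h1, H₂, h2, h3, h4⟩
      exact G.asymm ((key _ h1 _ _).1 h3) ((key _ h2 _ _).1 h4)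

end Finite

end DAG

/-! Let t(G) be the number of tails of covered arcs. The theorem follows from ν₁(G) ≤ t(G) ≤ 2ν₁(G)
and the invariance of t on the Markov equivalence class.

Intervening on all tails separates the ends of every covered arc, which suffices for verification;
this gives the first inequality. For the second, the vertices of an atomic verifying set must meet
every covered arc. A tail outside this set has a covered child inside it, and distinct tails have
distinct covered children (`Covered.left_unique`), so at most ν₁(G) tails lie inside and at most
ν₁(G) outside.

Invariance: Markov equivalent DAGs are joined by reversals of covered arcs
(`exists_covered_reversed`), and reversing `u → v` sends tails to tails via the transposition of `u`
and `v` (`exists_covered_swap`). -/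

namespace DAG

variable {V : Type*}

/-! ### Covered arcs and their reversal -/

/-- An arc `u → v` is covered if the parents of `v` are `u` and the parents of `u`. -/
def Covered (G : DAG V) (u v : V) : Prop :=
  ∀ w, G.Adj w v ↔ w = u ∨ G.Adj w u

theorem Covered.adj {G : DAG V} {u v : V} (h : G.Covered u v) : G.Adj u v :=
  (h u).2 (Or.inl rfl)

/-- Every vertex is the head of at most one covered arc. -/
theorem Covered.left_unique {G : DAG V} {u u' v : V} (h : G.Covered u v) (h' : G.Covered u' v) :
    u = u' := by
  rcases (h u').1 h'.adj with e | e
  · exact e.symm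
  · rcases (h' u).1 h.adj with e' | e'
    · exact e'
    · exact absurd e' (G.asymm e)

/-- `H` arises from `G` by reversing the covered arc `u → v`. -/
structure IsCoveredReversal (G H : DAG V) (u v : V) : Prop where
  covered : G.Covered u v
  adj_iff : ∀ a b, H.Adj a b ↔ (a = v ∧ b = u) ∨ (G.Adj a b ∧ ¬ (a = u ∧ b = v))

namespace IsCoveredReversal

variable {G H : DAG V} {u v : V}

theorem adj_tail (h : IsCoveredReversal G H u v) (a : V) : H.Adj a u ↔ a = v ∨ G.Adj a u := by
  have := G.ne_of_adj h.covered.adj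
  rw [h.adj_iff]
  grind

theorem adj_head (h : IsCoveredReversal G H u v) (a : V) : H.Adj a v ↔ G.Adj a u := by
  have := G.ne_of_adj h.covered.adj
  have h1 := h.covered a
  have h2 : ¬ G.Adj u u := fun h => G.ne_of_adj h rfl
  rw [h.adj_iff]
  grind

theorem adj_other (h : IsCoveredReversal G H u v) {b : V} (hu : b ≠ u) (hv : b ≠ v) (a : V) :
    H.Adj a b ↔ G.Adj a b := by
  rw [h.adj_iff]
  grind

theorem symm (h : IsCoveredReversal G H u v) : IsCoveredReversal H G v u where
  covered w := by rw [h.adj_tail, h.adj_head]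
  adj_iff a b := by
    have h1 := h.covered.adj
    have h2 := G.asymm h1
    rw [h.adj_iff]
    by_cases hab : a = u ∧ b = v
    · obtain ⟨rfl, rfl⟩ := hab
      simp [h1]
    · by_cases hba : a = v ∧ b = u
      · obtain ⟨rfl, rfl⟩ := hba
        simpa [h2] using fun e e' => hab ⟨e, e'⟩
      · simp [hab, hba]

theorem intervene (h : IsCoveredReversal G H u v) {S : Finset V} (hu : u ∉ S) (hv : v ∉ S) :
    IsCoveredReversal (G.intervene S) (H.intervene S) u v where
  covered w := by
    have := h.covered w
    simp only [DAG.intervene, hu, hv, not_false_eq_true, and_true, this]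
  adj_iff a b := by
    simp only [DAG.intervene, h.adj_iff]
    constructor
    · rintro ⟨h1 | h1, h2⟩
      · exact Or.inl h1
      · exact Or.inr ⟨⟨h1.1, h2⟩, h1.2⟩
    · rintro (⟨rfl, rfl⟩ | h1)
      · exact ⟨Or.inl ⟨rfl, rfl⟩, hu⟩
      · exact ⟨Or.inr ⟨h1.1.1, h1.2⟩, h1.1.2⟩

/-- A vertex with an outgoing covered arc keeps one under a covered reversal, up to exchanging the
two reversed vertices. -/
theorem exists_covered_swap [DecidableEq V] (h : IsCoveredReversal G H u v) {w : V}
    (hw : ∃ c, G.Covered w c) : ∃ c, H.Covered (Equiv.swap u v w) c := by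
  obtain ⟨c, hc⟩ := hw
  have huv := h.covered
  by_cases hwu : w = u
  · subst hwu
    rw [Equiv.swap_apply_left]
    exact ⟨w, h.symm.covered⟩
  by_cases hwv : w = v
  · subst hwv
    rw [Equiv.swap_apply_right]
    have h1 : c ≠ w := (G.ne_of_adj hc.adj).symm
    have h2 : c ≠ u := by
      rintro rfl
      exact G.asymm huv.adj hc.adj
    -- With `w = v`, the parents of `c` are `u`, `v` and the `G`-parents of `u`. In `H` the last two
    -- make up the parents of `u`, so `u → c` is covered.
    refine ⟨c, fun x => ?_⟩
    rw [h.adj_other h2 h1, h.adj_tail, hc x, huv x]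
    tauto
  rw [Equiv.swap_apply_of_ne_of_ne hwu hwv]
  by_cases hcv : c = v
  · subst hcv
    exact absurd (hc.left_unique huv) hwu
  by_cases hcu : c = u
  · subst hcu
    -- In `H` the vertex `v` has the old parents of `u`, so `w → v` takes over from `w → u`.
    refine ⟨v, fun x => ?_⟩
    rw [h.adj_head, h.adj_other hwu hwv]
    exact hc x
  · refine ⟨c, fun x => ?_⟩
    rw [h.adj_other hcu hcv, h.adj_other hwu hwv]
    exact hc x

end IsCoveredReversal

/-- A relation that strictly increases some rank has no directed cycles. -/
theorem not_transGen_self_of_rank {R : V → V → Prop} (r : V → ℕ) (hr : ∀ a b, R a b → r a < r b)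
    (v : V) : ¬ Relation.TransGen R v v := by
  intro h
  have : ∀ w, Relation.TransGen R v w → r v < r w := by
    intro w hw
    induction hw with
    | single h => exact hr _ _ h
    | tail _ h ih => exact ih.trans (hr _ _ h)
  exact lt_irrefl _ (this v h)

section Finite

variable [Fintype V]

theorem exists_rank (G : DAG V) : ∃ r : V → ℕ, ∀ a b, G.Adj a b → r a < r b := by
  -- The rank counts proper ancestors.
  refine ⟨fun v => {x | Relation.TransGen G.Adj x v}.ncard, fun a b h => ?_⟩
  apply Set.ncard_lt_ncard _ (Set.toFinite _)
  refine ⟨fun x hx => Relation.TransGen.tail hx h, fun hsub => ?_⟩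
  exact G.acyclic a (hsub (Relation.TransGen.single h : Relation.TransGen G.Adj a b))

theorem Covered.exists_reversal {G : DAG V} {u v : V} (h : G.Covered u v) :
    ∃ H, IsCoveredReversal G H u v := by
  classical
  obtain ⟨r, hr⟩ := G.exists_rank
  have huv := G.ne_of_adj h.adj
  refine ⟨{ Adj := fun a b => (a = v ∧ b = u) ∨ (G.Adj a b ∧ ¬ (a = u ∧ b = v))
            acyclic := not_transGen_self_of_rank
              -- Doubling the ranks makes room to move `v` just before `u`; the other parents of `v`
              -- are parents of `u`, hence still earlier.
              (fun x => if x = v then 2 * r u else if x = u then 2 * r u + 1 else 2 * r x) ?_ },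
    h, fun a b => Iff.rfl⟩
  intro a b hab
  have h1 := hr _ _ h.adj
  rcases hab with ⟨rfl, rfl⟩ | ⟨hab, hne⟩
  · simp [huv]
  · have h2 := hr _ _ hab
    have h3 := G.ne_of_adj hab
    by_cases hb : b = v
    · subst hb
      have h4 : a ≠ u := fun e => hne ⟨e, rfl⟩
      have h5 := hr _ _ (((h a).1 hab).resolve_left h4)
      simp only [h3, h4, if_true, if_false]
      omega
    · by_cases hav : a = v
      · subst hav
        have h4 : b ≠ u := by
          rintro rfl
          exact G.asymm hab h.adj
        simp only [hb, h4, if_true, if_false]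
        omega
      · by_cases hau : a = u
        · subst hau
          simp only [hb, hav, h3.symm, if_true, if_false]
          omega
        · by_cases hbu : b = u
          · subst hbu
            simp only [hb, hav, hau, if_true, if_false]
            omega
          · simp only [hb, hav, hau, hbu, if_false]
            omega

/-! ### Covered reversals preserve the Markov model -/

theorem MarkovEquiv.refl (G : DAG V) : MarkovEquiv G G := fun _ _ _ _ => Iff.rfl

theorem MarkovEquiv.trans {G H K : DAG V} (h : MarkovEquiv G H) (h' : MarkovEquiv H K) :
    MarkovEquiv G K := fun Ω _ _ f => (h Ω f).trans (h' Ω f)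

/-- By Bayes' formula, a factorization survives the reversal of a covered arc. -/
theorem IsCoveredReversal.factorizes {G H : DAG V} {u v : V} (h : IsCoveredReversal G H u v)
    {Ω : V → Type} [∀ v, Fintype (Ω v)] {f : (∀ v, Ω v) → ℝ} (hf : G.Factorizes Ω f) :
    H.Factorizes Ω f := by
  classical
  obtain ⟨k, hk, hk0, hk1, hkf⟩ := hf
  have huv := G.ne_of_adj h.covered.adj
  -- `j` is the joint law of `(u, v)` given the parents of `u`, `m` its marginal at `v`, and `q`
  -- below the conditional law of `u` given `v`. On null events `q` defaults to `k u`, to remain a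
  -- probability distribution.
  let j : (∀ w, Ω w) → Ω u → Ω v → ℝ := fun x a b => k u x a * k v (Function.update x u a) b
  let m : (∀ w, Ω w) → Ω v → ℝ := fun x b => ∑ a, j x a b
  have hj0 : ∀ x a b, 0 ≤ j x a b := fun x a b => mul_nonneg (hk0 _ _ _) (hk0 _ _ _)
  have hm0 : ∀ x b, 0 ≤ m x b := fun x b => Finset.sum_nonneg fun a _ => hj0 x a b
  have hj : ∀ x y, (∀ w, G.Adj w u → x w = y w) → j x = j y := by
    intro x y hxy
    funext a b
    have e1 : k u x = k u y := hk u x y hxy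
    have e2 : k v (Function.update x u a) = k v (Function.update y u a) := by
      apply hk
      intro w hw
      rcases (h.covered w).1 hw with rfl | hw
      · simp
      · have := G.ne_of_adj hw
        simp [this, hxy w hw]
    simp only [j, e1, e2]
  have hm : ∀ x y, (∀ w, G.Adj w u → x w = y w) → m x = m y := by
    intro x y hxy
    simp only [m, hj x y hxy]
  let q : (∀ w, Ω w) → Ω u → ℝ := fun x a =>
    if m x (x v) = 0 then k u x a else j x a (x v) / m x (x v)
  let k' : ∀ w, (∀ w, Ω w) → Ω w → ℝ := Function.update (Function.update k v m) u q
  have hku : k' u = q := Function.update_self ..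
  have hkv : k' v = m := by
    simp only [k', Function.update_of_ne huv.symm, Function.update_self]
  have hkw : ∀ w, w ≠ u → w ≠ v → k' w = k w := by
    intro w h1 h2
    simp only [k', Function.update_of_ne h1, Function.update_of_ne h2]
  refine ⟨k', ?_, ?_, ?_, ?_⟩
  · intro w x y hxy
    by_cases hwu : w = u
    · subst hwu
      have hP : ∀ z, G.Adj z w → x z = y z := fun z hz => hxy z ((h.adj_tail z).2 (Or.inr hz))
      have hV : x v = y v := hxy v ((h.adj_tail v).2 (Or.inl rfl))
      rw [hku]
      simp only [q, hm x y hP, hj x y hP, hV, hk w x y hP]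
    · by_cases hwv : w = v
      · subst hwv
        rw [hkv]
        exact hm x y fun z hz => hxy z ((h.adj_head z).2 hz)
      · rw [hkw w hwu hwv]
        exact hk w x y fun z hz => hxy z ((h.adj_other hwu hwv z).2 hz)
  · intro w x a
    by_cases hwu : w = u
    · subst hwu
      rw [hku]
      simp only [q]
      split_ifs
      · exact hk0 _ _ _
      · exact div_nonneg (hj0 _ _ _) (hm0 _ _)
    · by_cases hwv : w = v
      · subst hwv
        rw [hkv]
        exact hm0 _ _
      · rw [hkw w hwu hwv]
        exact hk0 _ _ _
  · intro w x
    by_cases hwu : w = u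
    · subst hwu
      rw [hku]
      by_cases h0 : m x (x v) = 0
      · simp only [q, h0, if_true, hk1]
      · simp only [q, h0, if_false]
        rw [← Finset.sum_div]
        exact div_self h0
    · by_cases hwv : w = v
      · subst hwv
        rw [hkv]
        simp only [m, j]
        rw [Finset.sum_comm]
        simp only [← Finset.mul_sum, hk1, mul_one]
      · rw [hkw w hwu hwv]
        exact hk1 _ _
  · intro x
    have hsplit : ∀ g : V → ℝ, ∏ w, g w = g u * g v * ∏ w ∈ {u, v}ᶜ, g w := by
      intro g
      rw [← Finset.prod_pair huv, Finset.prod_mul_prod_compl]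
    have hrest : ∏ w ∈ ({u, v} : Finset V)ᶜ, k' w x (x w) = ∏ w ∈ {u, v}ᶜ, k w x (x w) := by
      apply Finset.prod_congr rfl
      intro w hw
      simp only [Finset.mem_compl, Finset.mem_insert, Finset.mem_singleton, not_or] at hw
      rw [hkw w hw.1 hw.2]
    have hj' : j x (x u) (x v) = k u x (x u) * k v x (x v) := by
      simp only [j, Function.update_eq_self]
    rw [hkf, hsplit, hsplit (fun w => k' w x (x w)), hrest, hku, hkv, ← hj']
    congr 1
    by_cases h0 : m x (x v) = 0
    · rw [h0, mul_zero]
      exact (Finset.sum_eq_zero_iff_of_nonneg fun a _ => hj0 x a (x v)).1 h0 _ (Finset.mem_univ _)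
    · simp only [q, h0, if_false]
      rw [div_mul_cancel₀ _ h0]

theorem IsCoveredReversal.markovEquiv {G H : DAG V} {u v : V} (h : IsCoveredReversal G H u v) :
    MarkovEquiv G H := fun _ _ _ _ => ⟨h.factorizes, h.symm.factorizes⟩

/-! ### V-structures and the existence of a reversed covered arc -/

/-- Markov equivalent DAGs have the same v-structures: if two independent fair bits `u`, `v` and
their sum modulo two `t` factorize, then `t` is a collider. -/
theorem MarkovEquiv.adj_collider {G H : DAG V} (e : MarkovEquiv G H) {u v t : V} (hu : G.Adj u t)
    (hv : G.Adj v t) (huv : u ≠ v) (h1 : ¬ G.Adj u v) (h2 : ¬ G.Adj v u) : H.Adj u t := by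
  classical
  have hut : u ≠ t := G.ne_of_adj hu
  have hvt : v ≠ t := G.ne_of_adj hv
  have h1' : ¬ H.Adj u v := fun h => (e.symm.adj_or h).elim h1 h2
  have h2' : ¬ H.Adj v u := fun h => (e.symm.adj_or h).elim h2 h1
  let Ω : V → Type := fun w => {b : Bool // b = true → w = u ∨ w = v ∨ w = t}
  have : ∀ w, Nonempty (Ω w) := fun w => ⟨⟨false, by simp⟩⟩
  let f : (∀ w, Ω w) → ℝ := fun x => if (x t).1 = xor (x u).1 (x v).1 then 1 / 4 else 0
  have hprod : ∀ g : V → ℝ, (∀ w, w ≠ u → w ≠ v → w ≠ t → g w = 1) →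
      ∏ w, g w = g u * g v * g t := by
    intro g hg
    have : ∏ w ∈ {u, v, t}, g w = g u * g v * g t := by
      rw [Finset.prod_insert (by simp [huv, hut]), Finset.prod_pair hvt, mul_assoc]
    rw [← this]
    symm
    apply Finset.prod_subset (Finset.subset_univ _)
    intro w _ hw
    simp only [Finset.mem_insert, Finset.mem_singleton, not_or] at hw
    exact hg w hw.1 hw.2.1 hw.2.2
  have hsum : ∀ w, ∀ (hw : w = u ∨ w = v ∨ w = t), ∀ g : Ω w → ℝ,
      ∑ a, g a = g ⟨false, by simp⟩ + g ⟨true, fun _ => hw⟩ := by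
    intro w hw g
    have hne : (⟨false, by simp⟩ : Ω w) ≠ ⟨true, fun _ => hw⟩ := by
      intro hc
      have := congrArg Subtype.val hc
      simp at this
    rw [← Finset.sum_pair hne]
    symm
    apply Finset.sum_subset (Finset.subset_univ _)
    rintro ⟨_ | _, hb⟩ _ hw' <;> simp at hw'
  have hsum1 : ∀ w, w ≠ u → w ≠ v → w ≠ t → ∀ g : Ω w → ℝ, ∀ b, ∑ a, g a = g b := by
    intro w h1 h2 h3 g b
    apply Fintype.sum_eq_single
    intro a ha
    have hfalse : ∀ b : Ω w, b.1 = false := by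
      intro b
      rcases hb : b.1 with _ | _
      · rfl
      · exact absurd (b.2 hb) (by simp [h1, h2, h3])
    exact absurd (Subtype.ext ((hfalse a).trans (hfalse b).symm)) ha
  have hG : G.Factorizes Ω f := by
    refine ⟨fun w x a => if w = u then 1 / 2 else if w = v then 1 / 2 else if w = t then
      (if a.1 = xor (x u).1 (x v).1 then 1 else 0) else 1, ?_, ?_, ?_, ?_⟩
    · intro w x y hxy
      funext a
      by_cases ht : w = t
      · subst ht
        simp only [hxy u hu, hxy v hv]
      · simp [ht]
    · intro w x a
      dsimp only
      split_ifs <;> norm_num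
    · intro w x
      by_cases hwu : w = u
      · rw [hsum w (Or.inl hwu)]
        simp only [hwu, if_true]
        norm_num
      by_cases hwv : w = v
      · rw [hsum w (Or.inr (Or.inl hwv))]
        simp only [hwv, huv.symm, if_true, if_false]
        norm_num
      by_cases hwt : w = t
      · rw [hsum w (Or.inr (Or.inr hwt))]
        simp only [hwt, hut.symm, hvt.symm, if_true, if_false]
        rcases xor (x u).1 (x v).1 with _ | _ <;> simp
      · rw [hsum1 w hwu hwv hwt _ ⟨false, by simp⟩]
        simp [hwu, hwv, hwt]
    · intro x
      rw [hprod _ (fun w h1 h2 h3 => by simp [h1, h2, h3])]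
      simp only [f, huv.symm, hut.symm, hvt.symm, if_true, if_false]
      split_ifs <;> norm_num
  obtain ⟨k, hk, -, hk1, hf⟩ := (e Ω f).1 hG
  by_contra hno
  -- Set `u` to `a`, `v` to `b` and all else, including `t`, to false. If `u` is not a parent of `t`
  -- in `H`, then `f (c a b)` is a product of a function of `a` and one of `b`; but it is a nonzero
  -- multiple of the 2 × 2 identity matrix, which has rank two.
  let c : Bool → Bool → ∀ w, Ω w := fun a b w =>
    ⟨(decide (w = u) && a) || (decide (w = v) && b), by
      intro hb
      simp only [Bool.or_eq_true, Bool.and_eq_true, decide_eq_true_eq] at hb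
      tauto⟩
  have hcv : ∀ a a' b w, w ≠ u → c a b w = c a' b w := by
    intro a a' b w hw
    simp [c, hw]
  have hcu : ∀ a b b' w, w ≠ v → c a b w = c a b' w := by
    intro a b b' w hw
    simp [c, hw]
  have hfc : ∀ a b, f (c a b) = k u (c a false) (c a false u) *
      (k v (c false b) (c false b v) * k t (c false b) (c false b t)) := by
    intro a b
    rw [hf, hprod, mul_assoc]
    · congr 1
      · rw [hk u (c a b) (c a false), hcu a b false u huv]
        intro w hw
        exact hcu a b false w (fun hc => h2' (hc ▸ hw))
      · congr 1
        · rw [hk v (c a b) (c false b), hcv a false b v huv.symm]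
          intro w hw
          exact hcv a false b w (fun hc => h1' (hc ▸ hw))
        · rw [hk t (c a b) (c false b), hcv a false b t hut.symm]
          intro w hw
          exact hcv a false b w (fun hc => hno (hc ▸ hw))
    · intro w h1 h2 h3
      rw [← hsum1 w h1 h2 h3 (k w (c a b)), hk1]
  have e1 := hfc true true
  have e2 := hfc false false
  have e3 := hfc true false
  have hval : ∀ a b, f (c a b) = if a = b then 1 / 4 else 0 := by
    intro a b
    cases a <;> cases b <;> simp [f, c, huv, huv.symm, hut.symm, hvt.symm]
  rw [hval] at e1 e2 e3
  simp only [if_true, Bool.true_eq_false, if_false] at e1 e2 e3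
  rcases mul_eq_zero.1 e3.symm with h0 | h0
  · rw [h0] at e1
    norm_num at e1
  · rw [h0] at e2
    norm_num at e2

theorem MarkovEquiv.exists_adj_reversed {G H : DAG V} (e : MarkovEquiv G H) (hne : H ≠ G) :
    ∃ x y, G.Adj x y ∧ H.Adj y x := by
  by_contra! hno
  apply hne
  have h1 : ∀ x y, G.Adj x y → H.Adj x y := fun x y h =>
    (e.adj_or h).resolve_right (hno x y h)
  apply DAG.ext
  funext x y
  refine propext ⟨fun h => ?_, h1 x y⟩
  exact (e.symm.adj_or h).resolve_right fun h' => H.asymm h (h1 _ _ h')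

/-- Of two distinct Markov equivalent DAGs, the first has a covered arc that the second reverses. -/
theorem MarkovEquiv.exists_covered_reversed {G H : DAG V} (e : MarkovEquiv G H) (hne : H ≠ G) :
    ∃ x y, G.Covered x y ∧ H.Adj y x := by
  classical
  obtain ⟨r, hr⟩ := G.exists_rank
  obtain ⟨x₀, y₀, h₀⟩ := e.exists_adj_reversed hne
  -- Take the earliest head `y` of a reversed arc and its latest reversed parent `x`. Any failure of
  -- covering then forces a directed cycle in `H` or a collider present in only one of the two DAGs.
  obtain ⟨y, hy, hymin⟩ := Finset.exists_min_image
    (Finset.univ.filter fun y => ∃ x, G.Adj x y ∧ H.Adj y x) r ⟨y₀, by simpa using ⟨x₀, h₀⟩⟩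
  obtain ⟨x₁, hx₁⟩ := (Finset.mem_filter.1 hy).2
  obtain ⟨x, hx, hxmax⟩ := Finset.exists_max_image
    (Finset.univ.filter fun x => G.Adj x y ∧ H.Adj y x) r ⟨x₁, by simpa using hx₁⟩
  obtain ⟨hxy, hyx⟩ := (Finset.mem_filter.1 hx).2
  have hkeep : ∀ a b, G.Adj a b → r b < r y → H.Adj a b := by
    intro a b hab hlt
    refine (e.adj_or hab).resolve_right fun hba => ?_
    exact absurd (hymin b (by simpa using ⟨a, hab, hba⟩)) (not_le.2 hlt)
  refine ⟨x, y, fun w => ⟨fun hw => ?_, ?_⟩, hyx⟩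
  · by_cases hwx : w = x
    · exact Or.inl hwx
    · refine Or.inr ?_
      by_contra hno
      by_cases hxw : G.Adj x w
      · have hwy : H.Adj w y := by
          refine (e.adj_or hw).resolve_right fun hyw => ?_
          exact absurd (hxmax w (by simpa using ⟨hw, hyw⟩)) (not_le.2 (hr _ _ hxw))
        have hxw' := hkeep x w hxw (hr _ _ hw)
        exact H.acyclic x (((Relation.TransGen.single hxw').tail hwy).tail hyx)
      · exact H.asymm hyx (e.adj_collider hxy hw (Ne.symm hwx) hxw hno)
  · rintro (rfl | hw)
    · exact hxy
    · have hwx := hkeep w x hw (hr _ _ hxy)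
      by_contra hno
      have hyw : ¬ G.Adj y w := fun h =>
        G.acyclic w (((Relation.TransGen.single hw).tail hxy).tail h)
      have hwy : w ≠ y := by
        rintro rfl
        exact G.asymm hw hxy
      refine G.asymm hxy (e.symm.adj_collider hyx hwx hwy.symm ?_ ?_)
      · exact fun h => (e.symm.adj_or h).elim hyw hno
      · exact fun h => (e.symm.adj_or h).elim hno hyw

/-! ### Invariance of the number of tails -/

/-- The number of vertices with an outgoing covered arc. -/
noncomputable def coveredTailCount (G : DAG V) : ℕ := {u | ∃ v, G.Covered u v}.ncard

theorem IsCoveredReversal.coveredTailCount_le {G H : DAG V} {u v : V}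
    (h : IsCoveredReversal G H u v) : G.coveredTailCount ≤ H.coveredTailCount := by
  classical
  exact Set.ncard_le_ncard_of_injOn (Equiv.swap u v) (fun _ hw => h.exists_covered_swap hw)
    (Equiv.injective _).injOn (Set.toFinite _)

/-- The number of vertices with an outgoing covered arc depends only on the Markov equivalence
class. -/
theorem MarkovEquiv.coveredTailCount_eq {G H : DAG V} (e : MarkovEquiv G H) :
    G.coveredTailCount = H.coveredTailCount := by
  -- Induction on the number of arcs oriented oppositely in `G` and `H`: reversing a covered one
  -- lowers it.
  induction hn : {p : V × V | G.Adj p.1 p.2 ∧ H.Adj p.2 p.1}.ncard using Nat.strong_induction_on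
    generalizing G with
  | _ n ih =>
    by_cases hne : H = G
    · rw [hne]
    obtain ⟨u, v, hc, hvu⟩ := e.exists_covered_reversed hne
    obtain ⟨K, hK⟩ := hc.exists_reversal
    rw [le_antisymm hK.coveredTailCount_le hK.symm.coveredTailCount_le]
    refine ih _ ?_ (hK.markovEquiv.symm.trans e) rfl
    rw [← hn]
    apply Set.ncard_lt_ncard _ (Set.toFinite _)
    refine ⟨?_, fun hsub => ?_⟩
    · rintro ⟨a, b⟩ ⟨h1, h2⟩
      rcases (hK.adj_iff a b).1 h1 with ⟨rfl, rfl⟩ | h3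
      · exact absurd h2 (H.asymm hvu)
      · exact ⟨h3.1, h2⟩
    · have h1 : K.Adj u v := (hsub (show (u, v) ∈ _ from ⟨hc.adj, hvu⟩)).1
      exact K.asymm hK.symm.covered.adj h1

/-! ### Verifying sets and covered arcs -/

theorem mem_interventionalMEC_self (G : DAG V) (I : Finset (Finset V)) :
    G ∈ G.interventionalMEC I := ⟨MarkovEquiv.refl G, fun _ _ => MarkovEquiv.refl _⟩

/-- Interventions that separate the ends of every covered arc form a verifying set. -/
theorem isVerifyingSet_of_covered {G : DAG V} {I : Finset (Finset V)}
    (hI : ∀ u v, G.Covered u v → ∃ S ∈ I, (u ∈ S ↔ v ∉ S)) : G.IsVerifyingSet I := by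
  have key : ∀ H ∈ G.interventionalMEC I, H = G := by
    intro H hH
    by_contra hne
    obtain ⟨u, v, hc, hvu⟩ := MarkovEquiv.exists_covered_reversed hH.1 hne
    obtain ⟨S, hS, hSuv⟩ := hI u v hc
    have e := hH.2 S hS
    -- `S` contains exactly one end, so only one orientation of the arc survives the intervention,
    -- and the skeletons of `G_S` and `H_S` differ.
    by_cases hu : u ∈ S
    · have h1 : (G.intervene S).Adj u v := ⟨hc.adj, hSuv.1 hu⟩
      rcases e.adj_or h1 with h2 | h2
      · exact H.asymm hvu h2.1
      · exact h2.2 hu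
    · have hv : v ∈ S := by
        by_contra hv
        exact hu (hSuv.2 hv)
      have h1 : (H.intervene S).Adj v u := ⟨hvu, hu⟩
      rcases e.symm.adj_or h1 with h2 | h2
      · exact G.asymm hc.adj h2.1
      · exact h2.2 hv
  apply PDGraph.ext
  · funext u v
    refine propext ⟨fun h => h G (G.mem_interventionalMEC_self I), fun h H hH => ?_⟩
    rw [key H hH]
    exact h
  · funext u v
    refine propext ⟨?_, False.elim⟩
    rintro ⟨H₁, h1, H₂, h2, h3, h4⟩
    rw [key H₁ h1] at h3
    rw [key H₂ h2] at h4
    exact G.asymm h3 h4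

/-- Every covered arc meets one of the interventions of a verifying set. -/
theorem IsVerifyingSet.exists_mem_of_covered {G : DAG V} {I : Finset (Finset V)}
    (hI : G.IsVerifyingSet I) {u v : V} (h : G.Covered u v) : ∃ S ∈ I, u ∈ S ∨ v ∈ S := by
  by_contra! hno
  obtain ⟨H, hH⟩ := h.exists_reversal
  -- An arc missed by every intervention stays covered in each interventional graph, so its reversal
  -- goes undetected.
  have hmem : H ∈ G.interventionalMEC I :=
    ⟨hH.markovEquiv, fun S hS => (hH.intervene (hno S hS).1 (hno S hS).2).markovEquiv⟩
  have harc : (G.essentialGraph I).Arc u v := by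
    rw [hI]
    exact h.adj
  exact H.asymm hH.symm.covered.adj (harc H hmem)

theorem verificationNumber_le_coveredTailCount (G : DAG V) :
    G.verificationNumber ≤ G.coveredTailCount := by
  classical
  let T : Finset V := Finset.univ.filter fun u => ∃ v, G.Covered u v
  refine Nat.sInf_le ⟨T.image fun v => {v}, ?_, isVerifyingSet_of_covered ?_, ?_⟩
  · intro S hS
    obtain ⟨v, -, rfl⟩ := Finset.mem_image.1 hS
    exact Finset.card_singleton v
  · intro u v h
    refine ⟨{u}, Finset.mem_image_of_mem _ (by simpa [T] using ⟨v, h⟩), ?_⟩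
    simpa using (G.ne_of_adj h.adj).symm
  · rw [Finset.card_image_of_injective _ Finset.singleton_injective, coveredTailCount,
      ← Set.ncard_coe_finset]
    simp [T]

theorem coveredTailCount_le_two_mul_verificationNumber (G : DAG V) :
    G.coveredTailCount ≤ 2 * G.verificationNumber := by
  classical
  obtain ⟨I₀, hA₀, hV₀⟩ := G.exists_atomic_verifyingSet
  obtain ⟨I, hA, hV, hcard⟩ : G.verificationNumber ∈
      {n | ∃ I : Finset (Finset V), IsAtomic I ∧ G.IsVerifyingSet I ∧ I.card = n} :=
    Nat.sInf_mem ⟨_, I₀, hA₀, hV₀, rfl⟩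
  let K : Set V := {v | {v} ∈ I}
  let T : Set V := {u | ∃ v, G.Covered u v}
  have hK : K.ncard ≤ G.verificationNumber := by
    rw [← hcard, ← Set.ncard_coe_finset I]
    exact Set.ncard_le_ncard_of_injOn (fun v => {v}) (fun v hv => hv)
      Finset.singleton_injective.injOn (Set.toFinite _)
  have hcover : ∀ u v, G.Covered u v → u ∈ K ∨ v ∈ K := by
    intro u v h
    obtain ⟨S, hS, huv⟩ := hV.exists_mem_of_covered h
    obtain ⟨w, rfl⟩ := Finset.card_eq_one.1 (hA S hS)
    simp only [Finset.mem_singleton] at huv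
    rcases huv with rfl | rfl
    · exact Or.inl hS
    · exact Or.inr hS
  have h1 : (T ∩ K).ncard ≤ K.ncard := Set.ncard_le_ncard Set.inter_subset_right (Set.toFinite _)
  -- Tails outside `K` inject into `K` by choosing a covered child; the value of `c` off `T` is
  -- arbitrary.
  have h2 : (T \ K).ncard ≤ K.ncard := by
    have hchild : ∀ u, ∃ v, u ∈ T → G.Covered u v := fun u =>
      if hu : u ∈ T then hu.imp fun v hv _ => hv else ⟨u, fun h => absurd h hu⟩
    choose c hc using hchild
    refine Set.ncard_le_ncard_of_injOn c (fun u hu => ?_) (fun u hu u' hu' he => ?_)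
      (Set.toFinite _)
    · exact (hcover u _ (hc u hu.1)).resolve_left hu.2
    · have h := hc u hu.1
      rw [he] at h
      exact h.left_unique (hc u' hu'.1)
  have h3 := Set.ncard_inter_add_ncard_sdiff_eq_ncard T K (Set.toFinite _)
  change T.ncard ≤ _
  omega

end Finite

end DAG

theorem mainTheorem1 {V : Type*} [Fintype V] (G₀ : DAG V) :
    ∃ M m : ℕ,
      IsGreatest (DAG.verificationNumber '' G₀.MEC) M ∧
      IsLeast (DAG.verificationNumber '' G₀.MEC) m ∧
      M ≤ 2 * m := by
  have hle : ∀ G ∈ G₀.MEC, ∀ H ∈ G₀.MEC, G.verificationNumber ≤ 2 * H.verificationNumber := by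
    intro G hG H hH
    have e : DAG.MarkovEquiv G H := (DAG.MarkovEquiv.symm hG).trans hH
    calc G.verificationNumber ≤ G.coveredTailCount := G.verificationNumber_le_coveredTailCount
      _ = H.coveredTailCount := e.coveredTailCount_eq
      _ ≤ 2 * H.verificationNumber := H.coveredTailCount_le_two_mul_verificationNumber
  have hself : G₀ ∈ G₀.MEC := DAG.MarkovEquiv.refl G₀
  have hne : (DAG.verificationNumber '' G₀.MEC).Nonempty := ⟨_, G₀, hself, rfl⟩
  have hbdd : BddAbove (DAG.verificationNumber '' G₀.MEC) := by
    refine ⟨2 * G₀.verificationNumber, ?_⟩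
    rintro _ ⟨G, hG, rfl⟩
    exact hle G hG G₀ hself
  refine ⟨_, _, ⟨Nat.sSup_mem hne hbdd, fun _ h => le_csSup hbdd h⟩,
    ⟨Nat.sInf_mem hne, fun _ h => Nat.sInf_le h⟩, ?_⟩
  obtain ⟨G, hG, hGM⟩ := Nat.sSup_mem hne hbdd
  obtain ⟨H, hH, hHm⟩ := Nat.sInf_mem hne
  rw [← hGM, ← hHm]
  exact hle G hG H hH
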